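/- Let $D \ge 0$ and let $Y=(X,\{R_i\}_{0\le i\le D})$ be a symmetric association scheme on a finite set $X$. That is, $R_0,\dots,R_D$ are nonempty symmetric relations partitioning $X\times X$, $R_0$ is the identity relation, and there are numbers $p^h_{ij}$ such that for all $(x,y)\in R_h$ exactly $p^h_{ij}$ points $z$ satisfy $(x,z)\in R_i$ and $(z,y)\in R_j$. Let $A_i$ denote the $0$-$1$ matrix of $R_i$. Suppose that $Y$ is bipartite $P$-polynomial: for some reordering of the relations that keeps $R_0$ in place, $p^h_{ij}=0$ whenever one of $h,i,j$ is greater than the sum of the other two, $p^h_{ij}\neq 0$ whenever one of $h,i,j$ is equal to the sum of the other two, and the graph $(X,R_1)$ is bipartite (this last condition being void for $D=0$). Let $E_0,\dots,E_D$ be an ordering of the primitive idempotents of $Y$, that is, of the nonzero, mutually orthogonal idempotents with sum $I$ that form a basis of the complex span of $A_0,\dots,A_D$, with $E_0=|X|^{-1}J$ where $J$ is the all-ones matrix. Define the Krein parameters $q^h_{ij}$ by $E_i\circ E_j=|X|^{-1}\sum_{h} q^h_{ij}E_h$, where $\circ$ is the entrywise product. Suppose that $Y$ is $Q$-polynomial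 with respect to this ordering: $q^h_{ij}=0$ whenever one of $h,i,j$ is greater than the sum of the other two, and $q^h_{ij}\ne0$ whenever one of $h,i,j$ is equal to the sum of the other two. Then the corresponding sequence of multiplicities $m_0,m_1,\dots,m_D$, where $m_i=\operatorname{rank}E_i$, is unimodal: there is an index $k$ with $m_0\le\cdots\le m_k\ge m_{k+1}\ge\cdots\ge m_D$. -/

import Mathlib

open scoped Matrix

/-- A symmetric association scheme with `D` classes on a finite set `X`.
The partition `R_0, …, R_D` of `X × X` into nonempty relations is given by the map `cls` that sends
a pair to the index of the relation containing it: `R_i = {(x, y) | cls x y = i}`. -/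
structure SymmAssocScheme (X : Type*) [Fintype X] (D : ℕ) where
  /-- the index of the relation that contains a given pair -/
  cls : X → X → Fin (D + 1)
  /-- every relation `R_i` is nonempty -/
  nonempty : ∀ i, ∃ x y, cls x y = i
  /-- `R_0` is the identity relation -/
  cls_eq_zero_iff : ∀ x y, cls x y = 0 ↔ x = y
  /-- every relation `R_i` is symmetric -/
  symm : ∀ x y, cls x y = cls y x
  /-- the intersection numbers, `p h i j` standing for `p^h_{ij}` -/
  p : Fin (D + 1) → Fin (D + 1) → Fin (D + 1) → ℕ
  /-- for `(x, y) ∈ R_h` there are exactly `p^h_{ij}` points `z` such that `(x, z) ∈ R_i` and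
  `(z, y) ∈ R_j` -/
  card_eq : ∀ h i j x y, cls x y = h →
    (Finset.univ.filter fun z => cls x z = i ∧ cls z y = j).card = p h i j

namespace SymmAssocScheme

variable {X : Type*} [Fintype X] {D : ℕ}

/-- The `i`-th associate matrix `A_i`. -/
def assocMatrix (Y : SymmAssocScheme X D) (i : Fin (D + 1)) : Matrix X X ℂ :=
  Matrix.of fun x y => if Y.cls x y = i then 1 else 0

/-- The Bose–Mesner algebra, as the linear span of the associate matrices. -/
def boseMesner (Y : SymmAssocScheme X D) : Submodule ℂ (Matrix X X ℂ) :=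
  Submodule.span ℂ (Set.range Y.assocMatrix)

/-- The graph on `X` in which `x` and `y` are adjacent when they are distinct and `(x, y) ∈ R_i`. -/
def graph (Y : SymmAssocScheme X D) (i : Fin (D + 1)) : SimpleGraph X where
  Adj x y := x ≠ y ∧ Y.cls x y = i
  symm := ⟨fun x y h => ⟨h.1.symm, (Y.symm y x).trans h.2⟩⟩
  loopless := ⟨fun _ h => h.1 rfl⟩

end SymmAssocScheme

/-- The triangle conditions on an array of structure constants, `c h i j` standing for `c^h_{ij}`:
`c^h_{ij}` is zero whenever one of `h, i, j` is greater than the sum of the other two, and nonzero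
whenever one of `h, i, j` is equal to the sum of the other two. -/
def TriangleConditions {D : ℕ} {K : Type*} [Zero K]
    (c : Fin (D + 1) → Fin (D + 1) → Fin (D + 1) → K) : Prop :=
  ∀ h i j : Fin (D + 1),
    (((h : ℕ) > i + j ∨ (i : ℕ) > h + j ∨ (j : ℕ) > h + i) → c h i j = 0) ∧
    (((h : ℕ) = i + j ∨ (i : ℕ) = h + j ∨ (j : ℕ) = h + i) → c h i j ≠ 0)

namespace SymmAssocScheme

variable {X : Type*} [Fintype X] {D : ℕ}

/-- `Y` is `P`-polynomial with respect to the ordering `R_{σ 0}, R_{σ 1}, …, R_{σ D}` of its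
relations, where `R_{σ 0}` is the identity relation. -/
def IsPPolynomial (Y : SymmAssocScheme X D) (σ : Equiv.Perm (Fin (D + 1))) : Prop :=
  σ 0 = 0 ∧ TriangleConditions fun h i j => Y.p (σ h) (σ i) (σ j)

/-- `Y` is bipartite `P`-polynomial: it is `P`-polynomial with respect to some ordering of the
relations, and the graph of the first nonidentity relation in that ordering is bipartite.
(For `D = 0` this graph has one vertex and no edges.) -/
def IsBipartitePPolynomial (Y : SymmAssocScheme X D) : Prop :=
  ∃ σ : Equiv.Perm (Fin (D + 1)), Y.IsPPolynomial σ ∧ (Y.graph (σ 1)).IsBipartite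

/-- `E_0, …, E_D` is an ordering of the primitive idempotents of `Y`: these are nonzero, mutually
orthogonal idempotents of the Bose–Mesner algebra with sum `I` (as the algebra has dimension
`D + 1`, they form a basis of it), and `E_0 = |X|⁻¹ J` with `J` the all-ones matrix. -/
structure IsIdempotentOrdering [DecidableEq X] (Y : SymmAssocScheme X D)
    (E : Fin (D + 1) → Matrix X X ℂ) : Prop where
  mem : ∀ i, E i ∈ Y.boseMesner
  ne_zero : ∀ i, E i ≠ 0
  complete : CompleteOrthogonalIdempotents E
  zero : E 0 = (Fintype.card X : ℂ)⁻¹ • Matrix.of fun _ _ => 1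

/-- `q` is the array of Krein parameters of `E_0, …, E_D`, with `q h i j` standing for `q^h_{ij}`:
`E_i ∘ E_j = |X|⁻¹ ∑_h q^h_{ij} E_h`, where `∘` is the entrywise product. -/
def IsKreinArray (E : Fin (D + 1) → Matrix X X ℂ)
    (q : Fin (D + 1) → Fin (D + 1) → Fin (D + 1) → ℂ) : Prop :=
  ∀ i j, E i ⊙ E j = (Fintype.card X : ℂ)⁻¹ • ∑ h, q h i j • E h

/-- `Y` is `Q`-polynomial with respect to the ordering `E_0, …, E_D` of its primitive
idempotents. -/
def IsQPolynomial [DecidableEq X] (Y : SymmAssocScheme X D)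
    (E : Fin (D + 1) → Matrix X X ℂ) : Prop :=
  Y.IsIdempotentOrdering E ∧ ∃ q, IsKreinArray E q ∧ TriangleConditions q

end SymmAssocScheme

/-- A finite sequence `m_0, …, m_D` is unimodal: for some index `k` it is weakly increasing up to
`k` and weakly decreasing from `k` on. -/
def IsUnimodalSeq {D : ℕ} (m : Fin (D + 1) → ℕ) : Prop :=
  ∃ k, MonotoneOn m (Set.Iic k) ∧ AntitoneOn m (Set.Ici k)

/-! The multiplicities are symmetric, `m_{D-i} = m_i`, and increase through the first half, so they
peak at `D / 2`.

Symmetry. Let `S` be the diagonal matrix of signs `±1` given by the bipartition. Conjugation by `S`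
permutes the primitive idempotents, and the Krein triangle conditions force this permutation to be
`i ↦ D - i` (`IsPQSystem.rev_eq_conj_sign`).

Growth. Fix a base point `x` and let `A*` be the dual adjacency matrix, diagonal with one eigenvalue
on each sphere around `x`. For `2 i + 1 ≤ D` the map `E_{i+1} A*` is injective on the image of `E_i`
(`IsPQSystem.raise_injective`), whence `m_i ≤ m_{i+1}`. By orthogonal decomposition it suffices to
treat subspaces `W` irreducible under `A` and `A*`. Three filtrations are used: `F` by idempotent
index, `G` by support in balls, `H` by support outside balls. Intersecting `F` with `G` or with `H`
gives Terwilliger's split decompositions of `W`. A vector killed by the raising map has its top part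
concentrated on a single sphere (from `F` and `H`), and such a part vanishes (from `F` and `G`)
provided `2 i < r' - r + 2 t`, where `t` is the least idempotent index met by `W` and `r`, `r'` are
the extreme radii of its support (`JointlyIrreducible.mem_pred_of_raise_mem`). The bound `D ≤ r' - r
+ 2 t` (`IsPQSystem.le_width`) supplies this: for `v` in the image of `E_t`, the mean of `|v|²` over
spheres is a polynomial of degree at most `2 t` in the dual eigenvalue. -/

/-! ### Split decompositions attached to a pair of filtrations -/

section Flags

variable {V : Type*} [AddCommGroup V] [Module ℂ V]

/-- Two increasing filtrations of a space on which two operators act: `A` has eigenvalue `θ b` on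
the `b`-th layer of `F` and raises `G` by one step, while `B` has eigenvalue `φ a` on the `a`-th
layer of `G` and raises `F` by one step. -/
structure FlagPair (A B : V →ₗ[ℂ] V) (F G : ℤ → Submodule ℂ V) (θ φ : ℤ → ℂ) : Prop where
  monoF : Monotone F
  monoG : Monotone G
  lowerF : ∀ b, ∀ v ∈ F b, A v - θ b • v ∈ F (b - 1)
  raiseF : ∀ b, ∀ v ∈ F b, B v ∈ F (b + 1)
  lowerG : ∀ a, ∀ v ∈ G a, B v - φ a • v ∈ G (a - 1)
  raiseG : ∀ a, ∀ v ∈ G a, A v ∈ G (a + 1)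

/-- A subspace is invariant under both operators. -/
def JointlyInvariant (A B : V →ₗ[ℂ] V) (W : Submodule ℂ V) : Prop :=
  (∀ v ∈ W, A v ∈ W) ∧ ∀ v ∈ W, B v ∈ W

/-- A jointly invariant subspace without proper nonzero jointly invariant subspaces. -/
def JointlyIrreducible (A B : V →ₗ[ℂ] V) (W : Submodule ℂ V) : Prop :=
  JointlyInvariant A B W ∧ ∀ Z ≤ W, JointlyInvariant A B Z → Z = ⊥ ∨ Z = W

variable {A B : V →ₗ[ℂ] V} {F G H : ℤ → Submodule ℂ V} {θ φ ψ : ℤ → ℂ} {W : Submodule ℂ V}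

/-- Modulo a scalar multiple of the vector, `A` moves the summand `a` into the summand `a + 1` and
`B` moves it into `a - 1`: one filtration index rises while the other falls, so their sum `n` is
preserved. -/
theorem FlagPair.jointlyInvariant_iSup (h : FlagPair A B F G θ φ) (hW : JointlyInvariant A B W)
    (n : ℤ) : JointlyInvariant A B (⨆ a : ℤ, W ⊓ (G a ⊓ F (n - a))) := by
  constructor
  · intro v hv
    refine Submodule.iSup_induction (motive := fun v => A v ∈ _) _ hv ?_ (by simp) ?_
    · rintro a x ⟨hxW, hxG, hxF⟩
      have e : A x = (A x - θ (n - a) • x) + θ (n - a) • x := by abel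
      rw [e]
      refine add_mem (Submodule.mem_iSup_of_mem (a + 1) ⟨?_, ?_, ?_⟩)
        (Submodule.smul_mem _ _ (Submodule.mem_iSup_of_mem a ⟨hxW, hxG, hxF⟩))
      · exact sub_mem (hW.1 x hxW) (Submodule.smul_mem _ _ hxW)
      · exact sub_mem (h.raiseG a x hxG)
          (Submodule.smul_mem _ _ (h.monoG (by omega : a ≤ a + 1) hxG))
      · rw [← sub_sub]
        exact h.lowerF _ x hxF
    · intro x y hx hy
      rw [map_add]
      exact add_mem hx hy
  · intro v hv
    refine Submodule.iSup_induction (motive := fun v => B v ∈ _) _ hv ?_ (by simp) ?_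
    · rintro a x ⟨hxW, hxG, hxF⟩
      have e : B x = (B x - φ a • x) + φ a • x := by abel
      rw [e]
      refine add_mem (Submodule.mem_iSup_of_mem (a - 1) ⟨?_, ?_, ?_⟩)
        (Submodule.smul_mem _ _ (Submodule.mem_iSup_of_mem a ⟨hxW, hxG, hxF⟩))
      · exact sub_mem (hW.2 x hxW) (Submodule.smul_mem _ _ hxW)
      · exact h.lowerG _ x hxG
      · rw [show n - (a - 1) = n - a + 1 by ring]
        exact sub_mem (h.raiseF _ x hxF)
          (Submodule.smul_mem _ _ (h.monoF (by omega : n - a ≤ n - a + 1) hxF))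
    · intro x y hx hy
      rw [map_add]
      exact add_mem hx hy

/-- If `v ≠ 0`, irreducibility makes the sum of the pieces with `n = a + b` all of `W`. Pieces with
`c > n - t` lie in `F (t - 1)` and vanish, while the others lie in `G (n - t)`, so `W ≤ G (n - t)`,
contrary to `hab`. -/
theorem FlagPair.eq_zero_of_mem (h : FlagPair A B F G θ φ) (hW : JointlyIrreducible A B W)
    {t : ℤ} (ht : W ⊓ F (t - 1) = ⊥) {a b : ℤ} (hab : ¬ W ≤ G (a + b - t)) {v : V}
    (hvW : v ∈ W) (hvG : v ∈ G a) (hvF : v ∈ F b) : v = 0 := by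
  have hmem : v ∈ ⨆ c : ℤ, W ⊓ (G c ⊓ F (a + b - c)) :=
    Submodule.mem_iSup_of_mem a ⟨hvW, hvG, by rwa [add_sub_cancel_left]⟩
  rcases hW.2 _ (iSup_le fun _ => inf_le_left) (h.jointlyInvariant_iSup hW.1 (a + b)) with h0 | h1
  · rwa [h0, Submodule.mem_bot] at hmem
  · refine absurd ?_ hab
    rw [← h1]
    refine iSup_le fun c => ?_
    by_cases hc : c ≤ a + b - t
    · exact inf_le_right.trans (inf_le_left.trans (h.monoG hc))
    · refine le_trans ?_ (ht.le.trans bot_le)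
      exact inf_le_inf_left _ (inf_le_right.trans (h.monoF (by omega)))

theorem FlagPair.iSup_eq (h : FlagPair A B F G θ φ) (hW : JointlyIrreducible A B W)
    {a b : ℤ} (hne : W ⊓ (G a ⊓ F b) ≠ ⊥) :
    ⨆ c : ℤ, W ⊓ (G c ⊓ F (a + b - c)) = W := by
  refine (hW.2 _ (iSup_le fun _ => inf_le_left)
    (h.jointlyInvariant_iSup hW.1 (a + b))).resolve_left fun h0 => hne ?_
  rw [eq_bot_iff, ← h0]
  refine le_trans ?_ (le_iSup _ a)
  rw [add_sub_cancel_left]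

/-- The split decomposition from `F` and `H` writes `v` as a part `f` in `F (i - 1)`, a part `u`
supported at radius at least `r + (i - t)`, and a part `z` further out. The last two are shown to
vanish: `z` lies too deep in `H`, and the hypothesis on `B v` makes `u` an eigenvector of `B`, hence
supported on one sphere. -/
theorem JointlyIrreducible.mem_pred_of_raise_mem (hG : FlagPair A B F G θ φ)
    (hH : FlagPair A B F H θ ψ) (hW : JointlyIrreducible A B W)
    {t r r' i : ℤ} (ht : W ⊓ F (t - 1) = ⊥) (ht' : W ⊓ F t ≠ ⊥)
    (hr : W ≤ H (-r)) (hr' : ¬ W ≤ H (-r - 1)) (hs : ¬ W ≤ G (r' - 1))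
    (heig : ∀ v ∈ H (-(r + (i - t))), B v = ψ (-(r + (i - t))) • v → v ∈ G (r + (i - t)))
    (hi : 2 * i < r' - r + 2 * t) {v : V} (hvW : v ∈ W) (hv : v ∈ F i) (hBv : B v ∈ F i) :
    v ∈ F (i - 1) := by
  have hsum : ⨆ c : ℤ, W ⊓ (H c ⊓ F (-r + t - c)) = W := by
    refine hH.iSup_eq hW ?_
    rwa [← inf_assoc, inf_eq_left.2 hr]
  set k := i - t with hk
  have hle : W ≤ (W ⊓ F (i - 1)) ⊔ (W ⊓ (H (-(r + k)) ⊓ F i)) ⊔ (W ⊓ H (-(r + k) - 1)) := by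
    conv_lhs => rw [← hsum]
    refine iSup_le fun c => ?_
    rcases lt_trichotomy c (-(r + k)) with hc | hc | hc
    · refine le_trans ?_ le_sup_right
      exact inf_le_inf_left _ (inf_le_left.trans (hH.monoG (by omega)))
    · refine le_trans ?_ (le_sup_right.trans le_sup_left)
      rw [hc, show -r + t - -(r + k) = i by omega]
    · refine le_trans ?_ (le_sup_left.trans le_sup_left)
      exact inf_le_inf_left _ (inf_le_right.trans (hH.monoF (by omega)))
  obtain ⟨w, hw, z, ⟨hzW, hzH⟩, rfl⟩ := Submodule.mem_sup.1 (hle hvW)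
  obtain ⟨f, ⟨hfW, hf⟩, u, ⟨huW, huH, huF⟩, rfl⟩ := Submodule.mem_sup.1 hw
  have hfi : f ∈ F i := hG.monoF (by omega) hf
  have hz0 : z = 0 := by
    refine hH.eq_zero_of_mem hW ht (a := -(r + k) - 1) (b := i) ?_ hzW hzH ?_
    · rwa [show -(r + k) - 1 + i - t = -r - 1 by omega]
    · have := sub_mem hv (add_mem hfi huF)
      rwa [add_sub_cancel_left] at this
  subst hz0
  rw [add_zero] at hv hBv ⊢
  have hBu : B u ∈ F i := by
    have h1 := hG.raiseF _ f hf
    rw [sub_add_cancel] at h1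
    have := sub_mem hBv h1
    rwa [map_add, add_sub_cancel_left] at this
  -- Subtracting the eigenvalue pushes `u` one step deeper into `H` while it stays in `F i`, the
  -- position already excluded for `z`.
  have hu0 : B u - ψ (-(r + k)) • u = 0 := by
    refine hH.eq_zero_of_mem hW ht (a := -(r + k) - 1) (b := i) ?_ ?_ ?_ ?_
    · rwa [show -(r + k) - 1 + i - t = -r - 1 by omega]
    · exact sub_mem (hW.1.2 u huW) (Submodule.smul_mem _ _ huW)
    · exact hH.lowerG _ u huH
    · exact sub_mem hBu (Submodule.smul_mem _ _ huF)
  have huG := heig u huH (sub_eq_zero.1 hu0)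
  -- Now `u` lies in `G (r + k) ⊓ F i`, with index sum minus `t` equal to `r + 2 (i - t)`, at most
  -- `r' - 1` by `hi`.
  have : u = 0 := by
    refine hG.eq_zero_of_mem hW ht (a := r + k) (b := i) (fun hle' => hs ?_) huW huG huF
    exact hle'.trans (hG.monoG (by omega))
  rwa [this, add_zero]

end Flags

/-! ### Orthogonal reduction to irreducible subspaces -/

section Inner

variable {V : Type*} [NormedAddCommGroup V] [InnerProductSpace ℂ V]
variable {A B : V →ₗ[ℂ] V} {F G H : ℤ → Submodule ℂ V} {θ φ ψ : ℤ → ℂ} {W : Submodule ℂ V}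

theorem JointlyInvariant.orthogonal (hA : A.IsSymmetric) (hB : B.IsSymmetric)
    (hW : JointlyInvariant A B W) : JointlyInvariant A B Wᗮ := by
  constructor
  · intro v hv w hw
    rw [← hA]
    exact hv _ (hW.1 w hw)
  · intro v hv w hw
    rw [← hB]
    exact hv _ (hW.2 w hw)

variable [FiniteDimensional ℂ V]

theorem Submodule.commute_starProjection (hW : ∀ v ∈ W, A v ∈ W) (hW' : ∀ v ∈ Wᗮ, A v ∈ Wᗮ)
    (v : V) : W.starProjection (A v) = A (W.starProjection v) := by
  refine Submodule.eq_starProjection_of_mem_of_inner_eq_zero (hW _ (by simp)) ?_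
  intro w hw
  rw [← map_sub]
  have := hW' _ (W.sub_starProjection_mem_orthogonal v)
  exact (Submodule.mem_orthogonal' _ _).1 this w hw

/-- Injectivity of the raising map on the first half of an eigenspace filtration. -/
theorem FlagPair.eq_zero_of_raise_mem (hA : A.IsSymmetric) (hB : B.IsSymmetric)
    (hG : FlagPair A B F G θ φ) (hH : FlagPair A B F H θ ψ) {D i : ℤ}
    (hF0 : F (-1) = ⊥) (hFD : F D = ⊤) (hGm : G (-1) = ⊥) (hGD : G D = ⊤)
    (hH0 : H 0 = ⊤) (hHm : H (-D - 1) = ⊥)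
    (heig : ∀ a, 0 ≤ a → ∀ v ∈ H (-a), B v = ψ (-a) • v → v ∈ G a)
    (hcomm : ∀ P : V →ₗ[ℂ] V, (∀ v, P (A v) = A (P v)) → ∀ b, ∀ v ∈ F b, P v ∈ F b)
    (hwidth : ∀ t r r' : ℤ, 0 ≤ t → ∀ v, v ≠ 0 → v ∈ F t → A v = θ t • v →
      v ∈ H (-r) → v ∈ G r' → D ≤ r' - r + 2 * t)
    (hi : 2 * i + 1 ≤ D) (hint : ∀ v ∈ F (i - 1), A v = θ i • v → v = 0)
    {v : V} (hv : v ∈ F i) (hAv : A v = θ i • v) (hBv : B v ∈ F i) : v = 0 := by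
  -- Induction on the dimension of an invariant subspace replaces a full decomposition into
  -- irreducibles. In the reducible case the projection of `v` to a smaller invariant `Z` is killed,
  -- so `v` lies in the smaller `W ⊓ Zᗮ`.
  suffices key : ∀ n : ℕ, ∀ W : Submodule ℂ V, Module.finrank ℂ W = n → JointlyInvariant A B W →
      ∀ v ∈ W, v ∈ F i → A v = θ i • v → B v ∈ F i → v = 0 from
    key _ ⊤ rfl ⟨fun _ _ => trivial, fun _ _ => trivial⟩ v trivial hv hAv hBv
  intro n
  induction n using Nat.strong_induction_on with
  | _ n ih =>
  intro W hn hW v hvW hv hAv hBv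
  by_cases hirr : JointlyIrreducible A B W
  · by_contra hv0
    have hWF : ∀ b : ℤ, b < 0 → W ⊓ F b = ⊥ := fun b hb =>
      eq_bot_iff.2 (inf_le_right.trans ((hG.monoF (by omega : b ≤ -1)).trans hF0.le))
    have hWne : W ≠ ⊥ := fun h => hv0 (by rwa [h, Submodule.mem_bot] at hvW)
    obtain ⟨t, ht, htmin⟩ := Int.exists_least_of_bdd (P := fun b => W ⊓ F b ≠ ⊥)
      ⟨0, fun z hz => not_lt.1 fun h => hz (hWF z h)⟩ ⟨D, by rwa [hFD, inf_top_eq]⟩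
    have ht1 : W ⊓ F (t - 1) = ⊥ := by
      by_contra h
      have := htmin _ h
      omega
    have ht0 : 0 ≤ t := not_lt.1 fun h => ht (hWF t h)
    obtain ⟨r', hr', hmin⟩ := Int.exists_least_of_bdd (P := fun b => W ≤ G b)
      ⟨0, fun z hz => not_lt.1 fun h => hWne (eq_bot_iff.2
        (hz.trans ((hG.monoG (by omega : z ≤ -1)).trans hGm.le)))⟩ ⟨D, by rw [hGD]; exact le_top⟩
    obtain ⟨s, hs, hsmin⟩ := Int.exists_least_of_bdd (P := fun b => W ≤ H b)
      ⟨-D, fun z hz => not_lt.1 fun h => hWne (eq_bot_iff.2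
        (hz.trans ((hH.monoG (by omega : z ≤ -D - 1)).trans hHm.le)))⟩
      ⟨0, by rw [hH0]; exact le_top⟩
    have hs0 : s ≤ 0 := hsmin _ (by rw [hH0]; exact le_top)
    obtain ⟨w, ⟨hwW, hwF⟩, hw0⟩ := Submodule.exists_mem_ne_zero_of_ne_bot ht
    have hAw : A w - θ t • w = 0 := by
      have : A w - θ t • w ∈ W ⊓ F (t - 1) :=
        ⟨sub_mem (hW.1 w hwW) (Submodule.smul_mem _ _ hwW), hG.lowerF _ w hwF⟩
      rwa [ht1, Submodule.mem_bot] at this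
    have hwd := hwidth t (-s) r' ht0 w hw0 hwF (sub_eq_zero.1 hAw)
      (by rw [neg_neg]; exact hs hwW) (hr' hwW)
    by_cases hit : i < t
    · have : v ∈ W ⊓ F (t - 1) := ⟨hvW, hG.monoF (by omega) hv⟩
      rw [ht1, Submodule.mem_bot] at this
      exact hv0 this
    refine hv0 (hint v ?_ hAv)
    refine hirr.mem_pred_of_raise_mem hG hH (r := -s) (r' := r') ht1 ht (by rwa [neg_neg]) ?_ ?_
      (heig _ (by omega)) (by omega) hvW hv hBv
    · intro h
      have := hsmin _ h
      omega
    · intro h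
      have := hmin _ h
      omega
  · unfold JointlyIrreducible at hirr
    push Not at hirr
    obtain ⟨Z, hZW, hZ, hZ0, hZne⟩ := hirr hW
    have hZo := hZ.orthogonal hA hB
    have hcA := Submodule.commute_starProjection hZ.1 hZo.1
    have hcB := Submodule.commute_starProjection hZ.2 hZo.2
    have h1F : ∀ b, ∀ v ∈ F b, Z.starProjection v ∈ F b :=
      hcomm (Z.starProjection : V →ₗ[ℂ] V) hcA
    have hpW : Z.starProjection v ∈ Z := by simp
    have h1 : Z.starProjection v = 0 := by
      refine ih _ ?_ Z rfl hZ _ hpW (h1F _ _ hv) ?_ ?_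
      · rw [← hn]
        exact Submodule.finrank_lt_finrank_of_lt (lt_of_le_of_ne hZW hZne)
      · rw [← hcA, hAv, map_smul]
      · rw [← hcB]
        exact h1F _ _ hBv
    refine ih _ ?_ (W ⊓ Zᗮ) rfl ⟨fun x hx => ⟨hW.1 x hx.1, hZo.1 x hx.2⟩,
      fun x hx => ⟨hW.2 x hx.1, hZo.2 x hx.2⟩⟩ v ⟨hvW, ?_⟩ hv hAv hBv
    · rw [← hn]
      refine Submodule.finrank_lt_finrank_of_lt (lt_of_le_of_ne inf_le_left fun h => hZ0 ?_)
      rw [inf_eq_left] at h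
      rw [eq_bot_iff, ← Submodule.inf_orthogonal_eq_bot Z]
      exact le_inf le_rfl (hZW.trans h)
    · have := Z.sub_starProjection_mem_orthogonal v
      rwa [h1, sub_zero] at this

end Inner

/-! ### Recurrences with triangle conditions -/

open Polynomial in
/-- Solutions of a recurrence whose coefficients satisfy the triangle conditions are polynomials
in the first term. -/
theorem TriangleConditions.exists_polynomial {D : ℕ} {K : Type*} [Field K]
    {c : Fin (D + 1) → Fin (D + 1) → Fin (D + 1) → K} (hc : TriangleConditions c) :
    ∃ p : Fin (D + 1) → K[X], (∀ i, (p i).natDegree ≤ i) ∧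
      ∀ f : Fin (D + 1) → K, f 0 = 1 → (∀ i, f 1 * f i = ∑ h, c h 1 i * f h) →
        ∀ i, f i = (p i).eval (f 1) := by
  suffices key : ∀ n (hn : n < D + 1), ∃ p : K[X], p.natDegree ≤ n ∧
      ∀ f : Fin (D + 1) → K, f 0 = 1 → (∀ i, f 1 * f i = ∑ h, c h 1 i * f h) →
        f ⟨n, hn⟩ = p.eval (f 1) by
    choose p hdeg hp using key
    exact ⟨fun i => p i i.2, fun i => hdeg i i.2, fun f h0 hf i => hp i i.2 f h0 hf⟩
  intro n
  induction n using Nat.strong_induction_on with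
  | _ n ih =>
  intro hn
  rcases n with _ | n
  · exact ⟨1, by simp, fun f h0 _ => by simpa using h0⟩
  have h1 : ((1 : Fin (D + 1)) : ℕ) = 1 := by
    rw [Fin.val_one', Nat.mod_eq_of_lt (by omega)]
  choose p hdeg hp using ih
  set j : Fin (D + 1) := ⟨n, by omega⟩
  set j' : Fin (D + 1) := ⟨n + 1, hn⟩
  have hne : c j' 1 j ≠ 0 := (hc j' 1 j).2 (Or.inl (by simp only [j, j', h1]; omega))
  -- The recurrence at index `n` is solved for its top term `f (n + 1)`, whose coefficient is
  -- nonzero; terms of higher index have zero coefficient.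
  refine ⟨C (c j' 1 j)⁻¹ * (X * p n (by omega) (by omega) -
    ∑ h : Fin (D + 1), if hh : (h : ℕ) < n + 1 then C (c h 1 j) * p h hh h.2 else 0), ?_, ?_⟩
  · refine (natDegree_C_mul_le _ _).trans ((natDegree_sub_le _ _).trans (max_le ?_ ?_))
    · refine natDegree_mul_le.trans ?_
      have := hdeg n (by omega) (by omega)
      have := natDegree_X_le (R := K)
      omega
    · refine natDegree_sum_le_of_forall_le _ _ fun h _ => ?_
      split_ifs with hh
      · exact (natDegree_C_mul_le _ _).trans ((hdeg _ _ _).trans hh.le)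
      · simp
  · intro f h0 hf
    have hj := hf j
    have hs : ∑ h, c h 1 j * f h = c j' 1 j * f j' +
        ∑ h : Fin (D + 1), if (h : ℕ) < n + 1 then c h 1 j * f h else 0 := by
      rw [← Finset.sum_erase_add _ _ (Finset.mem_univ j'), add_comm,
        ← Finset.sum_erase_add Finset.univ (fun h : Fin (D + 1) =>
          if (h : ℕ) < n + 1 then c h 1 j * f h else 0) (Finset.mem_univ j')]
      simp only [j', lt_irrefl, if_false, add_zero]
      congr 1
      refine Finset.sum_congr rfl fun h hh => ?_
      split_ifs with hlt
      · rfl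
      · have hhn : (h : ℕ) ≠ n + 1 := fun e => (Finset.mem_erase.1 hh).1 (Fin.ext e)
        rw [(hc h 1 j).1 (Or.inl (by simp only [h1, j]; omega)), zero_mul]
    rw [hs] at hj
    rw [eval_mul, eval_C, eval_sub, eval_mul, eval_X, ← hp n _ _ f h0 hf, eval_finsetSum,
      eq_inv_mul_iff_mul_eq₀ hne, eq_sub_iff_add_eq, hj]
    congr 1
    refine Finset.sum_congr rfl fun h _ => ?_
    split_ifs with hh
    · rw [eval_mul, eval_C, ← hp h hh h.2 f h0 hf]
    · simp

/-! ### The Bose–Mesner algebra, eigenmatrices and Krein parameters -/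

namespace SymmAssocScheme

variable {X : Type*} [Fintype X] {D : ℕ} {Y : SymmAssocScheme X D}

theorem assocMatrix_apply (j : Fin (D + 1)) (y z : X) :
    Y.assocMatrix j y z = if Y.cls y z = j then 1 else 0 := rfl

theorem mem_boseMesner_iff {M : Matrix X X ℂ} :
    M ∈ Y.boseMesner ↔ ∃ f : Fin (D + 1) → ℂ, ∑ j, f j • Y.assocMatrix j = M :=
  Submodule.mem_span_range_iff_exists_fun ℂ

theorem sum_smul_assocMatrix_apply (f : Fin (D + 1) → ℂ) (y z : X) :
    (∑ j, f j • Y.assocMatrix j) y z = f (Y.cls y z) := by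
  simp [Matrix.sum_apply, assocMatrix_apply]

theorem mem_boseMesner_of_apply {M : Matrix X X ℂ} (f : Fin (D + 1) → ℂ)
    (h : ∀ y z, M y z = f (Y.cls y z)) : M ∈ Y.boseMesner :=
  mem_boseMesner_iff.2 ⟨f, by ext y z; rw [sum_smul_assocMatrix_apply, h]⟩

theorem exists_apply_of_mem {M : Matrix X X ℂ} (h : M ∈ Y.boseMesner) :
    ∃ f : Fin (D + 1) → ℂ, ∀ y z, M y z = f (Y.cls y z) := by
  obtain ⟨f, rfl⟩ := mem_boseMesner_iff.1 h
  exact ⟨f, sum_smul_assocMatrix_apply f⟩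

theorem assocMatrix_mem (j : Fin (D + 1)) : Y.assocMatrix j ∈ Y.boseMesner :=
  Submodule.subset_span ⟨j, rfl⟩

theorem card_ne_zero (Y : SymmAssocScheme X D) : (Fintype.card X : ℂ) ≠ 0 := by
  obtain ⟨x, -⟩ := Y.nonempty 0
  have : Nonempty X := ⟨x⟩
  exact Nat.cast_ne_zero.2 Fintype.card_ne_zero

theorem cls_self (x : X) : Y.cls x x = 0 := (Y.cls_eq_zero_iff x x).2 rfl

theorem assocMatrix_zero [DecidableEq X] : Y.assocMatrix 0 = 1 := by
  ext y z
  simp only [assocMatrix_apply, Y.cls_eq_zero_iff, Matrix.one_apply]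

theorem assocMatrix_isHermitian (j : Fin (D + 1)) : (Y.assocMatrix j).IsHermitian := by
  ext y z
  rw [Matrix.conjTranspose_apply, assocMatrix_apply, assocMatrix_apply, Y.symm z y]
  split_ifs <;> simp

theorem transpose_of_mem {M : Matrix X X ℂ} (h : M ∈ Y.boseMesner) : Mᵀ = M := by
  obtain ⟨f, hf⟩ := exists_apply_of_mem h
  ext y z
  rw [Matrix.transpose_apply, hf, hf, Y.symm]

theorem assocMatrix_mul (i j : Fin (D + 1)) :
    Y.assocMatrix i * Y.assocMatrix j = ∑ h, (Y.p h i j : ℂ) • Y.assocMatrix h := by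
  ext y z
  rw [sum_smul_assocMatrix_apply, ← Y.card_eq _ i j y z rfl, Matrix.mul_apply]
  simp only [assocMatrix_apply, ← ite_and, mul_ite, mul_one, mul_zero, Finset.card_filter,
    Nat.cast_sum, Nat.cast_ite, Nat.cast_one, Nat.cast_zero]
  refine Finset.sum_congr rfl fun w _ => ?_
  simp only [and_comm]

theorem IsIdempotentOrdering.mul_self [DecidableEq X] {E : Fin (D + 1) → Matrix X X ℂ}
    (hE : Y.IsIdempotentOrdering E) (i : Fin (D + 1)) : E i * E i = E i :=
  hE.complete.idem i

theorem IsIdempotentOrdering.mul_of_ne [DecidableEq X] {E : Fin (D + 1) → Matrix X X ℂ}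
    (hE : Y.IsIdempotentOrdering E) {i j : Fin (D + 1)} (h : i ≠ j) : E i * E j = 0 :=
  hE.complete.ortho h

theorem IsIdempotentOrdering.sum_mul [DecidableEq X] {E : Fin (D + 1) → Matrix X X ℂ}
    (hE : Y.IsIdempotentOrdering E) (c : Fin (D + 1) → ℂ) (i : Fin (D + 1)) :
    (∑ l, c l • E l) * E i = c i • E i := by
  rw [Finset.sum_mul, Finset.sum_eq_single i]
  · rw [smul_mul_assoc, hE.mul_self]
  · intro l _ hl
    rw [smul_mul_assoc, hE.mul_of_ne hl, smul_zero]
  · simp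

theorem IsIdempotentOrdering.mul_sum [DecidableEq X] {E : Fin (D + 1) → Matrix X X ℂ}
    (hE : Y.IsIdempotentOrdering E) (c : Fin (D + 1) → ℂ) (i : Fin (D + 1)) :
    E i * (∑ l, c l • E l) = c i • E i := by
  rw [Finset.mul_sum, Finset.sum_eq_single i]
  · rw [mul_smul_comm, hE.mul_self]
  · intro l _ hl
    rw [mul_smul_comm, hE.mul_of_ne hl.symm, smul_zero]
  · simp

theorem IsIdempotentOrdering.linearIndependent [DecidableEq X] {E : Fin (D + 1) → Matrix X X ℂ}
    (hE : Y.IsIdempotentOrdering E) : LinearIndependent ℂ E := by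
  rw [Fintype.linearIndependent_iff]
  intro c hc i
  have := hE.sum_mul c i
  rw [hc, zero_mul] at this
  exact (smul_eq_zero.1 this.symm).resolve_right (hE.ne_zero i)

theorem IsIdempotentOrdering.span_range [DecidableEq X] {E : Fin (D + 1) → Matrix X X ℂ}
    (hE : Y.IsIdempotentOrdering E) : Submodule.span ℂ (Set.range E) = Y.boseMesner := by
  refine Submodule.eq_of_le_of_finrank_le ?_ ?_
  · rw [Submodule.span_le]
    rintro _ ⟨i, rfl⟩
    exact hE.mem i
  · rw [finrank_span_eq_card hE.linearIndependent]
    exact finrank_range_le_card _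

theorem IsIdempotentOrdering.exists_sum_eq [DecidableEq X] {E : Fin (D + 1) → Matrix X X ℂ}
    (hE : Y.IsIdempotentOrdering E) {M : Matrix X X ℂ} (hM : M ∈ Y.boseMesner) :
    ∃ c : Fin (D + 1) → ℂ, ∑ i, c i • E i = M := by
  rw [← hE.span_range] at hM
  exact (Submodule.mem_span_range_iff_exists_fun ℂ).1 hM

/-- `P` and `Q` are the first and second eigenmatrices: `P j i` is the eigenvalue of `A_j` on the
image of `E_i`, and `|X|⁻¹ Q i j` is the value of `E_i` on the relation `R_j`. -/
structure HasEigenmatrices (Y : SymmAssocScheme X D) (E : Fin (D + 1) → Matrix X X ℂ)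
    (P Q : Fin (D + 1) → Fin (D + 1) → ℂ) : Prop where
  assoc_eq : ∀ j, Y.assocMatrix j = ∑ i, P j i • E i
  entry : ∀ i y z, E i y z = (Fintype.card X : ℂ)⁻¹ * Q i (Y.cls y z)

theorem IsIdempotentOrdering.exists_eigenmatrices [DecidableEq X]
    {E : Fin (D + 1) → Matrix X X ℂ} (hE : Y.IsIdempotentOrdering E) :
    ∃ P Q, Y.HasEigenmatrices E P Q := by
  choose P hP using fun j => hE.exists_sum_eq (assocMatrix_mem (Y := Y) j)
  choose Q hQ using fun i => exists_apply_of_mem (hE.mem i)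
  refine ⟨P, fun i j => Fintype.card X * Q i j, fun j => (hP j).symm, fun i y z => ?_⟩
  rw [inv_mul_cancel_left₀ Y.card_ne_zero, hQ]

section Eigenmatrices

variable {E : Fin (D + 1) → Matrix X X ℂ} {P Q : Fin (D + 1) → Fin (D + 1) → ℂ}

theorem HasEigenmatrices.Q_mul (h : Y.HasEigenmatrices E P Q)
    {q : Fin (D + 1) → Fin (D + 1) → Fin (D + 1) → ℂ} (hq : IsKreinArray E q)
    (i j l : Fin (D + 1)) : Q i l * Q j l = ∑ k, q k i j * Q k l := by
  obtain ⟨y, z, rfl⟩ := Y.nonempty l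
  have := congrFun (congrFun (hq i j) y) z
  simp only [Matrix.hadamard_apply, Matrix.smul_apply, Matrix.sum_apply, h.entry, smul_eq_mul]
    at this
  have hN := Y.card_ne_zero
  have h2 : (Fintype.card X : ℂ)⁻¹ * ((Fintype.card X : ℂ)⁻¹ * (Q i (Y.cls y z) * Q j (Y.cls y z)))
      = (Fintype.card X : ℂ)⁻¹ * ((Fintype.card X : ℂ)⁻¹ * ∑ k, q k i j * Q k (Y.cls y z)) := by
    rw [Finset.mul_sum Finset.univ _ (Fintype.card X : ℂ)⁻¹]
    calc _ = (Fintype.card X : ℂ)⁻¹ * Q i (Y.cls y z) *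
            ((Fintype.card X : ℂ)⁻¹ * Q j (Y.cls y z)) := by ring
      _ = _ := this
      _ = _ := by
        congr 1
        exact Finset.sum_congr rfl fun k _ => by ring
  exact mul_left_cancel₀ (inv_ne_zero hN) (mul_left_cancel₀ (inv_ne_zero hN) h2)

theorem HasEigenmatrices.eq_of_Q_eq (h : Y.HasEigenmatrices E P Q) {j l : Fin (D + 1)}
    (heq : ∀ i, Q i j = Q i l) : j = l := by
  by_contra hne
  obtain ⟨y, z, hyz⟩ := Y.nonempty j
  obtain ⟨y', z', hyz'⟩ := Y.nonempty l
  have h1 : Y.assocMatrix j y z = Y.assocMatrix j y' z' := by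
    rw [h.assoc_eq]
    simp only [Matrix.sum_apply, Matrix.smul_apply, h.entry, hyz, hyz', heq]
  simp [assocMatrix_apply, hyz, hyz', Ne.symm hne] at h1

variable [DecidableEq X]

theorem HasEigenmatrices.assoc_mul (h : Y.HasEigenmatrices E P Q) (hE : Y.IsIdempotentOrdering E)
    (j i : Fin (D + 1)) : Y.assocMatrix j * E i = P j i • E i := by
  rw [h.assoc_eq, hE.sum_mul]

theorem HasEigenmatrices.mul_assoc (h : Y.HasEigenmatrices E P Q) (hE : Y.IsIdempotentOrdering E)
    (j i : Fin (D + 1)) : E i * Y.assocMatrix j = P j i • E i := by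
  rw [h.assoc_eq, hE.mul_sum]

theorem HasEigenmatrices.P_zero (h : Y.HasEigenmatrices E P Q) (hE : Y.IsIdempotentOrdering E)
    (i : Fin (D + 1)) : P 0 i = 1 := by
  have := h.assoc_mul hE 0 i
  rw [assocMatrix_zero, one_mul] at this
  exact (smul_left_injective ℂ (hE.ne_zero i) (by simpa using this)).symm

theorem HasEigenmatrices.Q_zero (h : Y.HasEigenmatrices E P Q) (hE : Y.IsIdempotentOrdering E)
    (j : Fin (D + 1)) : Q 0 j = 1 := by
  obtain ⟨y, z, rfl⟩ := Y.nonempty j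
  have := h.entry 0 y z
  rw [hE.zero] at this
  simpa [Y.card_ne_zero] using this

theorem HasEigenmatrices.P_mul (h : Y.HasEigenmatrices E P Q) (hE : Y.IsIdempotentOrdering E)
    (i j l : Fin (D + 1)) : P i l * P j l = ∑ k, (Y.p k i j : ℂ) * P k l := by
  refine smul_left_injective ℂ (hE.ne_zero l) ?_
  have h1 : Y.assocMatrix i * Y.assocMatrix j * E l = (P i l * P j l) • E l := by
    rw [Matrix.mul_assoc, h.assoc_mul hE, mul_smul_comm, h.assoc_mul hE, smul_smul, mul_comm]
  dsimp only
  rw [← h1, assocMatrix_mul, Finset.sum_mul, Finset.sum_smul]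
  refine Finset.sum_congr rfl fun k _ => ?_
  rw [smul_mul_assoc, h.assoc_mul hE, smul_smul]

theorem HasEigenmatrices.eq_of_P_eq (h : Y.HasEigenmatrices E P Q)
    (hE : Y.IsIdempotentOrdering E) {i l : Fin (D + 1)} (heq : ∀ j, P j i = P j l) : i = l := by
  by_contra hne
  obtain ⟨f, hf⟩ := mem_boseMesner_iff.1 (hE.mem i)
  have key : ∀ k, E i * E k = (∑ j, f j * P j k) • E k := by
    intro k
    rw [← hf, Finset.sum_mul, Finset.sum_smul]
    refine Finset.sum_congr rfl fun j _ => ?_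
    rw [smul_mul_assoc, h.assoc_mul hE, smul_smul]
  have h1 := key l
  rw [hE.mul_of_ne hne] at h1
  have h2 := key i
  rw [hE.mul_self] at h2
  simp only [heq] at h2
  rw [(smul_eq_zero.1 h1.symm).resolve_right (hE.ne_zero l), zero_smul] at h2
  exact hE.ne_zero i h2

/-- Every `P j i` is a polynomial in `P 1 i` that does not depend on `i`, and the eigenvalues of all
the `A_j` together separate the idempotents. -/
theorem HasEigenmatrices.P_one_injective (h : Y.HasEigenmatrices E P Q)
    (hE : Y.IsIdempotentOrdering E) (hp : TriangleConditions Y.p) :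
    Function.Injective (P 1) := by
  have hc : TriangleConditions fun h i j => (Y.p h i j : ℂ) := fun h i j =>
    ⟨fun hh => by simp [(hp h i j).1 hh], fun hh => by simp [(hp h i j).2 hh]⟩
  obtain ⟨p, -, hpoly⟩ := hc.exists_polynomial
  intro i l hil
  refine h.eq_of_P_eq hE fun j => ?_
  rw [hpoly (fun k => P k i) (h.P_zero hE i) (fun k => h.P_mul hE 1 k i),
    hpoly (fun k => P k l) (h.P_zero hE l) (fun k => h.P_mul hE 1 k l), hil]

open Polynomial in
theorem HasEigenmatrices.exists_polynomial_Q (h : Y.HasEigenmatrices E P Q)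
    (hE : Y.IsIdempotentOrdering E)
    {q : Fin (D + 1) → Fin (D + 1) → Fin (D + 1) → ℂ} (hq : IsKreinArray E q)
    (ht : TriangleConditions q) :
    ∃ p : Fin (D + 1) → ℂ[X], (∀ i, (p i).natDegree ≤ i) ∧ ∀ i j, Q i j = (p i).eval (Q 1 j) := by
  obtain ⟨p, hdeg, hpoly⟩ := ht.exists_polynomial
  exact ⟨p, hdeg, fun i j =>
    hpoly (fun k => Q k j) (h.Q_zero hE j) (fun k => h.Q_mul hq 1 k j) i⟩

theorem HasEigenmatrices.Q_one_injective (h : Y.HasEigenmatrices E P Q)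
    (hE : Y.IsIdempotentOrdering E)
    {q : Fin (D + 1) → Fin (D + 1) → Fin (D + 1) → ℂ} (hq : IsKreinArray E q)
    (ht : TriangleConditions q) : Function.Injective (Q 1) := by
  obtain ⟨p, -, hpoly⟩ := h.exists_polynomial_Q hE hq ht
  intro j l hjl
  refine h.eq_of_Q_eq fun i => ?_
  rw [hpoly i j, hpoly i l, hjl]

open scoped ComplexOrder in
theorem HasEigenmatrices.star_P (h : Y.HasEigenmatrices E P Q) (hE : Y.IsIdempotentOrdering E)
    (j i : Fin (D + 1)) : star (P j i) = P j i := by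
  have h1 : (E i)ᴴ * (Y.assocMatrix j * E i) = P j i • ((E i)ᴴ * E i) := by
    rw [h.assoc_mul hE, mul_smul_comm]
  have h2 := congrArg Matrix.conjTranspose h1
  rw [Matrix.conjTranspose_mul, Matrix.conjTranspose_mul, Matrix.conjTranspose_conjTranspose,
    (assocMatrix_isHermitian j).eq, Matrix.mul_assoc, h1, Matrix.conjTranspose_smul,
    Matrix.conjTranspose_mul, Matrix.conjTranspose_conjTranspose] at h2
  refine (smul_left_injective ℂ ?_ h2).symm
  rw [Ne, Matrix.conjTranspose_mul_self_eq_zero]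
  exact hE.ne_zero i

/-- Hermitian symmetry is not part of `IsIdempotentOrdering`. The `A_j` are Hermitian with real
eigenvalues, so distinct joint eigenspaces are orthogonal; thus `(E i)ᴴ = (E i)ᴴ * E i`, whose right
side is Hermitian. -/
theorem HasEigenmatrices.isHermitian (h : Y.HasEigenmatrices E P Q)
    (hE : Y.IsIdempotentOrdering E) (i : Fin (D + 1)) : (E i).IsHermitian := by
  have h0 : ∀ l, l ≠ i → (E i)ᴴ * E l = 0 := by
    intro l hl
    by_contra hne
    refine hl (h.eq_of_P_eq hE fun j => ?_)
    have h1 := congrArg Matrix.conjTranspose (h.assoc_mul hE j i)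
    rw [Matrix.conjTranspose_mul, (assocMatrix_isHermitian j).eq, Matrix.conjTranspose_smul,
      h.star_P hE] at h1
    have h2 : (E i)ᴴ * Y.assocMatrix j * E l = P j l • ((E i)ᴴ * E l) := by
      rw [Matrix.mul_assoc, h.assoc_mul hE, mul_smul_comm]
    rw [h1, smul_mul_assoc] at h2
    exact (smul_left_injective ℂ hne h2).symm
  have h1 : (E i)ᴴ = (E i)ᴴ * E i := by
    conv_lhs => rw [← mul_one (E i)ᴴ, ← hE.complete.complete, Finset.mul_sum]
    exact Finset.sum_eq_single i (fun l _ hl => h0 l hl) (by simp)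
  have h2 := congrArg Matrix.conjTranspose h1
  rw [Matrix.conjTranspose_mul, Matrix.conjTranspose_conjTranspose, ← h1] at h2
  exact h2.symm

theorem HasEigenmatrices.star_apply (h : Y.HasEigenmatrices E P Q)
    (hE : Y.IsIdempotentOrdering E) (i : Fin (D + 1)) (y z : X) : star (E i y z) = E i y z := by
  have h1 := (h.isHermitian hE i).apply z y
  rw [h1]
  exact congrFun (congrFun (transpose_of_mem (hE.mem i)) y) z

open scoped ComplexOrder in
theorem HasEigenmatrices.Q_apply_zero_ne (h : Y.HasEigenmatrices E P Q)
    (hE : Y.IsIdempotentOrdering E) (i : Fin (D + 1)) : Q i 0 ≠ 0 := by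
  intro h0
  refine hE.ne_zero i (Matrix.trace_conjTranspose_mul_self_eq_zero_iff.1 ?_)
  rw [(h.isHermitian hE i).eq, hE.mul_self, Matrix.trace]
  simp [h.entry, cls_self, h0]

theorem HasEigenmatrices.valency_mul (h : Y.HasEigenmatrices E P Q)
    (hE : Y.IsIdempotentOrdering E) (x : X) (i j : Fin (D + 1)) :
    ((Finset.univ.filter fun y => Y.cls x y = j).card : ℂ) * Q i j = P j i * Q i 0 := by
  have h1 := congrFun (congrFun (h.assoc_mul hE j i) x) x
  rw [Matrix.mul_apply, Matrix.smul_apply, h.entry, cls_self, smul_eq_mul] at h1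
  have h2 : ∑ y, Y.assocMatrix j x y * E i y x = (Fintype.card X : ℂ)⁻¹ *
      (((Finset.univ.filter fun y => Y.cls x y = j).card : ℂ) * Q i j) := by
    rw [Finset.card_filter, Nat.cast_sum, Finset.sum_mul, Finset.mul_sum]
    refine Finset.sum_congr rfl fun y _ => ?_
    rw [assocMatrix_apply, h.entry, Y.symm y x]
    split_ifs with hy
    · simp [hy]
    · simp
  rw [h2] at h1
  refine mul_left_cancel₀ (inv_ne_zero Y.card_ne_zero) (h1.trans ?_)
  ring

open scoped ComplexOrder in
/-- A vanishing Krein parameter makes the corresponding triple product of idempotents vanish. -/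
theorem HasEigenmatrices.mul_diagonal_mul_eq_zero (h : Y.HasEigenmatrices E P Q)
    (hE : Y.IsIdempotentOrdering E)
    {q : Fin (D + 1) → Fin (D + 1) → Fin (D + 1) → ℂ} (hq : IsKreinArray E q)
    {k i j : Fin (D + 1)} (h0 : q k i j = 0) (b : X) :
    E i * Matrix.diagonal (fun y => E k b y) * E j = 0 := by
  have hsym : ∀ l y z, E l y z = E l z y := fun l y z =>
    congrFun (congrFun (transpose_of_mem (hE.mem l)) z) y
  -- The squared Frobenius norm of the triple product equals the `(b, b)` entry of `E k * (E i ⊙ E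
  -- j) * E k`, which is proportional to `q k i j`.
  rw [← Matrix.trace_mul_conjTranspose_self_eq_zero_iff]
  have hd : (Matrix.diagonal (fun y => E k b y))ᴴ = Matrix.diagonal (fun y => E k b y) := by
    rw [Matrix.diagonal_conjTranspose]
    congr 1
    ext y
    exact h.star_apply hE k b y
  have h1 : E k * (E i ⊙ E j) * E k = 0 := by
    rw [hq, mul_smul_comm, hE.mul_sum, h0, zero_smul, smul_zero, zero_mul]
  have h2 := congrFun (congrFun h1 b) b
  rw [Matrix.conjTranspose_mul, Matrix.conjTranspose_mul, hd, (h.isHermitian hE i).eq,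
    (h.isHermitian hE j).eq, Matrix.mul_assoc _ (E j), ← Matrix.mul_assoc (E j), hE.mul_self,
    ← Matrix.mul_assoc, ← Matrix.mul_assoc, Matrix.trace_mul_comm, ← Matrix.mul_assoc,
    ← Matrix.mul_assoc, ← Matrix.mul_assoc, hE.mul_self]
  rw [Matrix.zero_apply, Matrix.mul_apply] at h2
  rw [← h2, Matrix.trace]
  refine Finset.sum_congr rfl fun z _ => ?_
  rw [Matrix.diag_apply, Matrix.mul_diagonal, Matrix.mul_apply, Matrix.mul_apply, hsym k z b]
  congr 1
  refine Finset.sum_congr rfl fun y _ => ?_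
  rw [Matrix.mul_diagonal, Matrix.hadamard_apply, hsym i z y]
  ring

end Eigenmatrices

end SymmAssocScheme

/-! ### The width bound, the dual adjacency matrix and the concrete filtrations -/

namespace SymmAssocScheme

section Basic

variable {X : Type*} {D : ℕ}

/-- The sequence on `Fin (D + 1)` extended to the integers. -/
def extendSeq (f : Fin (D + 1) → ℂ) (a : ℤ) : ℂ := f (Fin.ofNat (D + 1) a.toNat)

theorem extendSeq_coe (f : Fin (D + 1) → ℂ) (j : Fin (D + 1)) :
    extendSeq f ((j : ℕ) : ℤ) = f j := by
  rw [extendSeq, Int.toNat_natCast]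
  congr 1
  exact Fin.ext (by simp)

/-- The vectors that vanish at all points satisfying a given predicate. -/
def vanishingOn (p : X → Prop) : Submodule ℂ (EuclideanSpace ℂ X) where
  carrier := {v | ∀ y, p y → v y = 0}
  add_mem' hu hv y hy := by rw [PiLp.add_apply, hu y hy, hv y hy, add_zero]
  zero_mem' _ _ := rfl
  smul_mem' c v hv y hy := by rw [PiLp.smul_apply, hv y hy, smul_zero]

theorem vanishingOn_mono {p p' : X → Prop} (hpp : ∀ y, p' y → p y) :
    vanishingOn p ≤ vanishingOn p' := fun _ hv y hy => hv y (hpp y hy)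

variable [Fintype X] {Y : SymmAssocScheme X D}

theorem card_filter_cls_ne_zero (hp : TriangleConditions Y.p) (x : X) (j : Fin (D + 1)) :
    (Finset.univ.filter fun y => Y.cls x y = j).card ≠ 0 := by
  have h1 := Y.card_eq 0 j j x x (cls_self x)
  have h2 := (hp 0 j j).2 (Or.inr (Or.inl (by simp)))
  rw [← h1] at h2
  refine fun h => h2 ?_
  rw [← h]
  congr 1
  refine Finset.filter_congr fun y _ => ?_
  rw [Y.symm y x, and_self]

theorem cls_le_add_one (hp : TriangleConditions Y.p) (x : X) {y z : X} (hyz : Y.cls y z = 1) :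
    (Y.cls x y : ℕ) ≤ Y.cls x z + 1 := by
  by_contra h
  push Not at h
  have h1 : ((1 : Fin (D + 1)) : ℕ) ≤ 1 := by
    rw [Fin.val_one']
    exact Nat.mod_le _ _
  have h2 := (hp (Y.cls x y) (Y.cls x z) 1).1 (Or.inl (by omega))
  rw [← Y.card_eq _ _ _ x y rfl, Finset.card_eq_zero] at h2
  have : z ∈ (Finset.univ.filter fun w => Y.cls x w = Y.cls x z ∧ Y.cls w y = 1) := by
    simp [Y.symm z y, hyz]
  rw [h2] at this
  simp at this

end Basic

variable {X : Type*} [Fintype X] {D : ℕ}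

/-- The data of a scheme that is `P`-polynomial for the given ordering of its relations and
`Q`-polynomial for the ordering `E` of its idempotents. -/
structure IsPQSystem [DecidableEq X] (Y : SymmAssocScheme X D) (E : Fin (D + 1) → Matrix X X ℂ)
    (P Q : Fin (D + 1) → Fin (D + 1) → ℂ)
    (q : Fin (D + 1) → Fin (D + 1) → Fin (D + 1) → ℂ) : Prop where
  tri : TriangleConditions Y.p
  idem : Y.IsIdempotentOrdering E
  krein : IsKreinArray E q
  kreinTri : TriangleConditions q
  eig : Y.HasEigenmatrices E P Q

variable [DecidableEq X] {Y : SymmAssocScheme X D} {E : Fin (D + 1) → Matrix X X ℂ}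
  {P Q : Fin (D + 1) → Fin (D + 1) → ℂ} {q : Fin (D + 1) → Fin (D + 1) → Fin (D + 1) → ℂ}

/-- The entry at `b` is the Hermitian form of `E t * diagonal (E k b ·) * E t` at `v`. With the
triangle conditions this confines `|v|²` to the idempotents of index at most `2 t`. -/
theorem HasEigenmatrices.mulVec_mul_star_eq_zero (h : Y.HasEigenmatrices E P Q)
    (hE : Y.IsIdempotentOrdering E) (hq : IsKreinArray E q) {k t : Fin (D + 1)}
    (h0 : q k t t = 0) {v : X → ℂ} (hv : E t *ᵥ v = v) : E k *ᵥ (fun y => v y * star (v y)) = 0 := by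
  ext b
  have h1 := h.mul_diagonal_mul_eq_zero hE hq h0 b
  have h2 : star v ⬝ᵥ ((E t * Matrix.diagonal (fun y => E k b y) * E t) *ᵥ v) = 0 := by
    rw [h1, Matrix.zero_mulVec, dotProduct_zero]
  rw [← Matrix.mulVec_mulVec, hv, ← Matrix.mulVec_mulVec, Matrix.dotProduct_mulVec] at h2
  have h3 : star v ᵥ* E t = star v := by
    conv_rhs => rw [← hv, Matrix.star_mulVec, (h.isHermitian hE t).eq]
  rw [h3] at h2
  rw [Pi.zero_apply, ← h2]
  refine Finset.sum_congr rfl fun y _ => ?_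
  rw [Matrix.mulVec_diagonal, Pi.star_apply]
  ring

open scoped ComplexOrder in
open Polynomial in
/-- A nonzero vector in the image of `E_t` meets all but at most `2 t` of the spheres around a
point. -/
theorem IsPQSystem.le_width (h : Y.IsPQSystem E P Q q) (x : X) {t : Fin (D + 1)} {v : X → ℂ}
    (hv : E t *ᵥ v = v) (hv0 : v ≠ 0) {r r' : ℤ}
    (hlow : ∀ y, (Y.cls x y : ℤ) < r → v y = 0) (hup : ∀ y, r' < (Y.cls x y : ℤ) → v y = 0) :
    (D : ℤ) ≤ r' - r + 2 * (t : ℕ) := by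
  by_contra hlt
  push Not at hlt
  apply hv0
  set g : X → ℂ := fun y => v y * star (v y) with hg
  obtain ⟨p, hdeg, hQ⟩ := h.eig.exists_polynomial_Q h.idem h.krein h.kreinTri
  -- The value of `R` at the `j`-th dual eigenvalue is the mean of `|v|²` over the sphere of radius
  -- `j` around `x`.
  set R : ℂ[X] := ∑ i : Fin (D + 1), if (i : ℕ) ≤ 2 * t then
    C ((E i *ᵥ g) x / Q i 0) * p i else 0 with hR
  have hdegR : R.natDegree ≤ 2 * t := by
    refine natDegree_sum_le_of_forall_le _ _ fun i _ => ?_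
    split_ifs with hi
    · exact (natDegree_C_mul_le _ _).trans ((hdeg i).trans hi)
    · simp
  have hs : ∀ j, (Y.assocMatrix j *ᵥ g) x =
      ((Finset.univ.filter fun y => Y.cls x y = j).card : ℂ) * R.eval (Q 1 j) := by
    intro j
    rw [h.eig.assoc_eq, Matrix.sum_mulVec, Finset.sum_apply, hR, eval_finsetSum, Finset.mul_sum]
    refine Finset.sum_congr rfl fun i _ => ?_
    rw [Matrix.smul_mulVec, Pi.smul_apply, smul_eq_mul]
    split_ifs with hi
    · rw [eval_mul, eval_C, ← hQ, mul_left_comm, h.eig.valency_mul h.idem]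
      have := h.eig.Q_apply_zero_ne h.idem i
      field_simp
    · rw [h.eig.mulVec_mul_star_eq_zero h.idem h.krein
        ((h.kreinTri i t t).1 (Or.inl (by omega))) hv]
      simp
  have hAg : ∀ j, (Y.assocMatrix j *ᵥ g) x =
      ∑ y ∈ Finset.univ.filter (fun y => Y.cls x y = j), g y := by
    intro j
    rw [Finset.sum_filter]
    refine Finset.sum_congr rfl fun y _ => ?_
    change (if Y.cls x y = j then (1 : ℂ) else 0) * g y = _
    split_ifs <;> simp
  set S : Finset (Fin (D + 1)) := Finset.univ.filter fun j => (j : ℤ) < r ∨ r' < (j : ℤ)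
  have hroot : ∀ j ∈ S, R.eval (Q 1 j) = 0 := by
    intro j hj
    have h1 := hs j
    rw [hAg, Finset.sum_eq_zero] at h1
    · exact (mul_eq_zero.1 h1.symm).resolve_left
        (Nat.cast_ne_zero.2 (card_filter_cls_ne_zero h.tri x j))
    · intro y hy
      obtain rfl := (Finset.mem_filter.1 hy).2
      have : v y = 0 := by
        rcases (Finset.mem_filter.1 hj).2 with h2 | h2
        · exact hlow y h2
        · exact hup y h2
      simp [hg, this]
  -- At most `r' - r + 1` of the `D + 1` radii escape `S`, so a failure of the bound gives `R` more
  -- roots than its degree allows.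
  have hcard : 2 * (t : ℕ) < S.card := by
    have h1 : S.card + (Finset.univ.filter fun j : Fin (D + 1) =>
        ¬ ((j : ℤ) < r ∨ r' < (j : ℤ))).card = D + 1 := by
      rw [Finset.card_filter_add_card_filter_not, Finset.card_univ, Fintype.card_fin]
    by_cases hrr : r ≤ r'
    · have h2 : (Finset.univ.filter fun j : Fin (D + 1) =>
          ¬ ((j : ℤ) < r ∨ r' < (j : ℤ))).card ≤ (Finset.Icc r r').card := by
        refine Finset.card_le_card_of_injOn (fun j => (j : ℤ)) ?_ ?_
        · intro j hj
          have := (Finset.mem_filter.1 hj).2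
          simp only [Finset.coe_Icc, Set.mem_Icc]
          omega
        · intro a _ b _ hab
          exact Fin.ext (Int.ofNat_inj.1 hab)
      rw [Int.card_Icc] at h2
      omega
    · exfalso
      apply hv0
      ext y
      by_cases hy : (Y.cls x y : ℤ) < r
      · exact hlow y hy
      · exact hup y (by omega)
  have hR0 : R = 0 := by
    refine eq_zero_of_natDegree_lt_card_of_eval_eq_zero' R (S.image (Q 1)) ?_ ?_
    · intro c hc
      obtain ⟨j, hj, rfl⟩ := Finset.mem_image.1 hc
      exact hroot j hj
    · rw [Finset.card_image_of_injective _
        (h.eig.Q_one_injective h.idem h.krein h.kreinTri)]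
      omega
  refine dotProduct_self_star_eq_zero.1 ?_
  change ∑ y, g y = 0
  rw [← Finset.sum_fiberwise Finset.univ (fun y => Y.cls x y)]
  refine Finset.sum_eq_zero fun j _ => ?_
  rw [← hAg, hs, hR0, eval_zero, mul_zero]

/-- The vectors without component in the images of the idempotents beyond the `b`-th. -/
noncomputable def eigenFlag (E : Fin (D + 1) → Matrix X X ℂ) (b : ℤ) :
    Submodule ℂ (EuclideanSpace ℂ X) where
  carrier := {v | ∀ j : Fin (D + 1), b < (j : ℕ) → Matrix.toEuclideanLin (E j) v = 0}
  add_mem' hu hv j hj := by rw [map_add, hu j hj, hv j hj, add_zero]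
  zero_mem' j _ := map_zero _
  smul_mem' c v hv j hj := by rw [map_smul, hv j hj, smul_zero]

theorem toEuclideanLin_mul_apply (M N : Matrix X X ℂ) (v : EuclideanSpace ℂ X) :
    Matrix.toEuclideanLin (M * N) v = Matrix.toEuclideanLin M (Matrix.toEuclideanLin N v) := by
  rw [Matrix.toEuclideanLin, Matrix.toLpLin_mul_same, LinearMap.comp_apply]

theorem IsIdempotentOrdering.sum_toEuclideanLin (hE : Y.IsIdempotentOrdering E)
    (v : EuclideanSpace ℂ X) : ∑ i, Matrix.toEuclideanLin (E i) v = v := by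
  rw [← LinearMap.sum_apply, ← map_sum, hE.complete.complete, Matrix.toLpLin_one,
    LinearMap.id_apply]

/-- The dual adjacency matrix with respect to a base point. -/
def dualAdj (Y : SymmAssocScheme X D) (Q : Fin (D + 1) → Fin (D + 1) → ℂ) (x : X) :
    Matrix X X ℂ :=
  Matrix.diagonal fun y => Q 1 (Y.cls x y)

theorem IsPQSystem.mul_dualAdj_mul (h : Y.IsPQSystem E P Q q) (x : X) {i j : Fin (D + 1)}
    (hij : (i : ℕ) + 1 < j ∨ (j : ℕ) + 1 < i) : E i * Y.dualAdj Q x * E j = 0 := by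
  have h1 : ((1 : Fin (D + 1)) : ℕ) ≤ 1 := by
    rw [Fin.val_one']
    exact Nat.mod_le _ _
  have h0 : q 1 i j = 0 := by
    refine (h.kreinTri 1 i j).1 ?_
    omega
  have h2 := h.eig.mul_diagonal_mul_eq_zero h.idem h.krein h0 x
  have h3 : Y.dualAdj Q x =
      (Fintype.card X : ℂ) • Matrix.diagonal (fun y => E 1 x y) := by
    rw [dualAdj, ← Matrix.diagonal_smul]
    congr 1
    ext y
    rw [Pi.smul_apply, h.eig.entry, smul_eq_mul, mul_inv_cancel_left₀ Y.card_ne_zero]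
  rw [h3, mul_smul_comm, smul_mul_assoc, h2, smul_zero]

theorem IsPQSystem.dualAdj_isHermitian (h : Y.IsPQSystem E P Q q) (x : X) :
    (Y.dualAdj Q x).IsHermitian := by
  rw [Matrix.IsHermitian, dualAdj, Matrix.diagonal_conjTranspose]
  congr 1
  ext y
  have h1 := h.eig.star_apply h.idem 1 x y
  rw [h.eig.entry, star_mul', star_inv₀, star_natCast] at h1
  exact mul_left_cancel₀ (inv_ne_zero Y.card_ne_zero) h1

theorem eigenFlag_mono : Monotone (eigenFlag E) :=
  fun _ _ hab _ hv j hj => hv j (hab.trans_lt hj)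

theorem dualAdj_apply (v : EuclideanSpace ℂ X) (y : X) :
    Matrix.toEuclideanLin (Y.dualAdj Q x) v y = Q 1 (Y.cls x y) * v y := by
  rw [Matrix.toLpLin_apply]
  exact Matrix.mulVec_diagonal _ _ _

theorem adj_apply_eq_zero {v : EuclideanSpace ℂ X} {y : X}
    (hv : ∀ z, Y.cls y z = 1 → v z = 0) :
    Matrix.toEuclideanLin (Y.assocMatrix 1) v y = 0 := by
  rw [Matrix.toLpLin_apply]
  refine Finset.sum_eq_zero fun z _ => ?_
  change (if Y.cls y z = 1 then (1 : ℂ) else 0) * v z = 0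
  split_ifs with hz
  · exact mul_eq_zero_of_right _ (hv z hz)
  · rw [zero_mul]

theorem eigenFlag_neg_one (hE : Y.IsIdempotentOrdering E) : eigenFlag E (-1) = ⊥ := by
  refine eq_bot_iff.2 fun v hv => (Submodule.mem_bot ℂ).2 ?_
  rw [← hE.sum_toEuclideanLin v]
  exact Finset.sum_eq_zero fun j _ => hv j (by omega)

/-! ### Injectivity of the raising map and growth of the ranks -/

section Operators

variable (h : Y.IsPQSystem E P Q q) (x : X)
include h

theorem IsPQSystem.toEuclideanLin_assoc (j : Fin (D + 1)) (v : EuclideanSpace ℂ X) :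
    Matrix.toEuclideanLin (E j) (Matrix.toEuclideanLin (Y.assocMatrix 1) v) =
      P 1 j • Matrix.toEuclideanLin (E j) v := by
  rw [← toEuclideanLin_mul_apply, h.eig.mul_assoc h.idem, map_smul, LinearMap.smul_apply]

theorem IsPQSystem.toEuclideanLin_assoc' (j : Fin (D + 1)) (v : EuclideanSpace ℂ X) :
    Matrix.toEuclideanLin (Y.assocMatrix 1) (Matrix.toEuclideanLin (E j) v) =
      P 1 j • Matrix.toEuclideanLin (E j) v := by
  rw [← toEuclideanLin_mul_apply, h.eig.assoc_mul h.idem, map_smul, LinearMap.smul_apply]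

theorem IsPQSystem.lowerF (b : ℤ) (v : EuclideanSpace ℂ X) (hv : v ∈ eigenFlag E b) :
    Matrix.toEuclideanLin (Y.assocMatrix 1) v - extendSeq (P 1) b • v ∈ eigenFlag E (b - 1) := by
  intro j hj
  rw [map_sub, map_smul, h.toEuclideanLin_assoc, ← sub_smul]
  by_cases hb : b < (j : ℕ)
  · rw [hv j hb, smul_zero]
  · obtain rfl : b = (j : ℕ) := by omega
    rw [extendSeq_coe, sub_self, zero_smul]

theorem IsPQSystem.raiseF (b : ℤ) (v : EuclideanSpace ℂ X) (hv : v ∈ eigenFlag E b) :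
    Matrix.toEuclideanLin (Y.dualAdj Q x) v ∈ eigenFlag E (b + 1) := by
  intro j hj
  rw [← h.idem.sum_toEuclideanLin v, map_sum, map_sum]
  refine Finset.sum_eq_zero fun l _ => ?_
  by_cases hl : b < (l : ℕ)
  · rw [hv l hl, map_zero, map_zero]
  · rw [← toEuclideanLin_mul_apply, ← toEuclideanLin_mul_apply,
      h.mul_dualAdj_mul x (by omega), map_zero, LinearMap.zero_apply]

theorem IsPQSystem.flagPair_upper : FlagPair (Matrix.toEuclideanLin (Y.assocMatrix 1))
    (Matrix.toEuclideanLin (Y.dualAdj Q x)) (eigenFlag E)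
    (fun a => vanishingOn fun y => a < (Y.cls x y : ℕ)) (extendSeq (P 1)) (extendSeq (Q 1)) where
  monoF := eigenFlag_mono
  monoG _ _ hab := vanishingOn_mono fun _ hy => hab.trans_lt hy
  lowerF := h.lowerF
  raiseF := h.raiseF x
  lowerG a v hv y hy := by
    rw [PiLp.sub_apply, PiLp.smul_apply, dualAdj_apply, smul_eq_mul, ← sub_mul]
    by_cases ha : a < (Y.cls x y : ℕ)
    · rw [hv y ha, mul_zero]
    · obtain rfl : a = (Y.cls x y : ℕ) := by omega
      rw [extendSeq_coe, sub_self, zero_mul]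
  raiseG a v hv y hy := adj_apply_eq_zero fun z hz => hv z (by
    have := cls_le_add_one h.tri x hz
    omega)

/-- Indices are negated because the subspaces supported at radius at least `a` shrink as `a` grows,
whereas a `FlagPair` needs increasing filtrations. -/
theorem IsPQSystem.flagPair_lower : FlagPair (Matrix.toEuclideanLin (Y.assocMatrix 1))
    (Matrix.toEuclideanLin (Y.dualAdj Q x)) (eigenFlag E)
    (fun a => vanishingOn fun y => ((Y.cls x y : ℕ) : ℤ) < -a) (extendSeq (P 1))
    (fun a => extendSeq (Q 1) (-a)) where
  monoF := eigenFlag_mono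
  monoG _ _ hab := vanishingOn_mono fun _ hy => hy.trans_le (neg_le_neg hab)
  lowerF := h.lowerF
  raiseF := h.raiseF x
  lowerG a v hv y hy := by
    rw [PiLp.sub_apply, PiLp.smul_apply, dualAdj_apply, smul_eq_mul, ← sub_mul]
    by_cases ha : ((Y.cls x y : ℕ) : ℤ) < -a
    · rw [hv y ha, mul_zero]
    · obtain ha' : -a = (Y.cls x y : ℕ) := by omega
      rw [ha', extendSeq_coe, sub_self, zero_mul]
  raiseG a v hv y hy := adj_apply_eq_zero fun z hz => hv z (by
    have := cls_le_add_one h.tri x ((Y.symm z y).trans hz)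
    omega)

/-- Since the eigenvalues of `A_1` are distinct, a map commuting with `A_1` preserves the image of
each `E l`. -/
theorem IsPQSystem.map_eigenFlag {T : EuclideanSpace ℂ X →ₗ[ℂ] EuclideanSpace ℂ X}
    (hT : ∀ v, T (Matrix.toEuclideanLin (Y.assocMatrix 1) v) =
      Matrix.toEuclideanLin (Y.assocMatrix 1) (T v)) (b : ℤ) (v : EuclideanSpace ℂ X)
    (hv : v ∈ eigenFlag E b) : T v ∈ eigenFlag E b := by
  intro j hj
  rw [← h.idem.sum_toEuclideanLin v, map_sum, map_sum]
  refine Finset.sum_eq_zero fun l _ => ?_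
  by_cases hl : l = j
  · rw [hl, hv j hj, map_zero, map_zero]
  · have h1 := h.toEuclideanLin_assoc j (T (Matrix.toEuclideanLin (E l) v))
    rw [← hT, h.toEuclideanLin_assoc', map_smul, map_smul, ← sub_eq_zero, ← sub_smul] at h1
    exact (smul_eq_zero.1 h1).resolve_left
      (sub_ne_zero.2 fun e => hl (h.eig.P_one_injective h.idem h.tri e))

theorem IsPQSystem.eigenvector_component {t j : Fin (D + 1)} (htj : j ≠ t)
    {v : EuclideanSpace ℂ X}
    (hv : Matrix.toEuclideanLin (Y.assocMatrix 1) v = P 1 t • v) :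
    Matrix.toEuclideanLin (E j) v = 0 := by
  have h1 := h.toEuclideanLin_assoc j v
  rw [hv, map_smul, ← sub_eq_zero, ← sub_smul] at h1
  exact (smul_eq_zero.1 h1).resolve_left
    (sub_ne_zero.2 fun e => htj (h.eig.P_one_injective h.idem h.tri e).symm)

theorem IsPQSystem.eq_of_eigenvector {t : Fin (D + 1)} {v : EuclideanSpace ℂ X}
    (hv : Matrix.toEuclideanLin (Y.assocMatrix 1) v = P 1 t • v) :
    Matrix.toEuclideanLin (E t) v = v := by
  conv_rhs => rw [← h.idem.sum_toEuclideanLin v]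
  exact (Finset.sum_eq_single t (fun j _ hj => h.eigenvector_component hj hv) (by simp)).symm

/-- The dual adjacency matrix maps the image of `E_i` injectively to that of `E_{i+1}` when
`2 i + 1 ≤ D`. -/
theorem IsPQSystem.raise_injective {i j : Fin (D + 1)} (hj : (j : ℕ) = i + 1)
    (hi : 2 * (i : ℕ) + 1 ≤ D) {v : EuclideanSpace ℂ X}
    (hv : Matrix.toEuclideanLin (E i) v = v)
    (hBv : Matrix.toEuclideanLin (E j) (Matrix.toEuclideanLin (Y.dualAdj Q x) v) = 0) :
    v = 0 := by
  have hAv : Matrix.toEuclideanLin (Y.assocMatrix 1) v = P 1 i • v := by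
    conv_lhs => rw [← hv, h.toEuclideanLin_assoc', hv]
  refine (h.flagPair_upper x).eq_zero_of_raise_mem
    (Matrix.isSymmetric_toEuclideanLin_iff.2 (assocMatrix_isHermitian 1))
    (Matrix.isSymmetric_toEuclideanLin_iff.2 (h.dualAdj_isHermitian x)) (h.flagPair_lower x)
    (D := D) (i := (i : ℕ)) (eigenFlag_neg_one h.idem) ?_ ?_ ?_ ?_ ?_ ?_
    (fun T hT => h.map_eigenFlag hT) ?_ (by omega) ?_ ?_ (by rwa [extendSeq_coe]) ?_
  · exact eq_top_iff.2 fun w _ l hl => by omega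
  · exact eq_bot_iff.2 fun w hw => (Submodule.mem_bot ℂ).2 (by
      ext y
      exact hw y (by omega))
  · exact eq_top_iff.2 fun w _ y hy => by omega
  · exact eq_top_iff.2 fun w _ y hy => by omega
  · exact eq_bot_iff.2 fun w hw => (Submodule.mem_bot ℂ).2 (by
      ext y
      exact hw y (by omega))
  -- Distinct dual eigenvalues confine an eigenvector of the dual adjacency matrix to a single
  -- sphere.
  · intro a ha w hw hBw y hy
    have h1 : (Matrix.toEuclideanLin (Y.dualAdj Q x) w) y = extendSeq (Q 1) a * w y := by
      rw [hBw, neg_neg, PiLp.smul_apply, smul_eq_mul]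
    lift a to ℕ using ha
    have haD : a < D + 1 := by omega
    have h2 : extendSeq (Q 1) (a : ℤ) = Q 1 ⟨a, haD⟩ := extendSeq_coe (Q 1) ⟨a, haD⟩
    rw [dualAdj_apply, h2, ← sub_eq_zero, ← sub_mul] at h1
    refine (mul_eq_zero.1 h1).resolve_left (sub_ne_zero.2 fun e => ?_)
    have := h.eig.Q_one_injective h.idem h.krein h.kreinTri e
    rw [this] at hy
    simp at hy
  · intro t r r' ht w hw0 hwF hAw hwH hwG
    lift t to ℕ using ht
    have hwH' : ∀ y, (Y.cls x y : ℤ) < r → w y = 0 := fun y hy => hwH y (by rwa [neg_neg])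
    by_cases htD : t < D + 1
    · have h1 : extendSeq (P 1) (t : ℤ) = P 1 ⟨t, htD⟩ := extendSeq_coe (P 1) ⟨t, htD⟩
      rw [h1] at hAw
      have h2 := h.eq_of_eigenvector hAw
      refine h.le_width x (t := ⟨t, htD⟩) (v := w.ofLp) ?_ ?_ hwH' hwG
      · conv_rhs => rw [← h2]
        rfl
      · intro e
        exact hw0 (by ext y; exact congrFun e y)
    -- For `t > D` there is no idempotent `E t`, but the bound is trivial once the support is
    -- nonempty.
    · have : r ≤ r' := by
        by_contra hrr
        apply hw0
        ext y
        by_cases hy : (Y.cls x y : ℤ) < r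
        · exact hwH' y hy
        · exact hwG y (by omega)
      omega
  · intro w hw hAw
    rw [extendSeq_coe] at hAw
    rw [← h.eq_of_eigenvector hAw]
    exact hw i (by omega)
  · intro l hl
    exact h.eigenvector_component (by rintro rfl; omega) hAv
  · intro l hl
    by_cases hlj : l = j
    · rw [hlj, hBv]
    · have : (l : ℕ) ≠ j := fun e => hlj (Fin.ext e)
      rw [← hv, ← toEuclideanLin_mul_apply, ← toEuclideanLin_mul_apply,
        h.mul_dualAdj_mul x (by omega), map_zero, LinearMap.zero_apply]

/-- Injectivity says that `E j * A* * E i` has no larger kernel than `E i`; its rank is then at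
least that of `E i` and at most that of `E j`. -/
theorem IsPQSystem.rank_le_rank_succ {i j : Fin (D + 1)} (hj : (j : ℕ) = i + 1)
    (hi : 2 * (i : ℕ) + 1 ≤ D) : (E i).rank ≤ (E j).rank := by
  obtain ⟨x, -⟩ := Y.nonempty 0
  set M := E j * Y.dualAdj Q x * E i
  refine le_trans (b := M.rank) ?_
    ((Matrix.rank_mul_le_left _ _).trans (Matrix.rank_mul_le_left _ _))
  have hker : LinearMap.ker M.mulVecLin ≤ LinearMap.ker (E i).mulVecLin := by
    intro v hv
    rw [LinearMap.mem_ker, Matrix.mulVecLin_apply] at hv ⊢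
    have h1 : Matrix.toEuclideanLin (E i) (WithLp.toLp 2 v) = 0 := by
      refine h.raise_injective x hj hi ?_ ?_
      · rw [← toEuclideanLin_mul_apply, h.idem.mul_self]
      · rw [← toEuclideanLin_mul_apply, ← toEuclideanLin_mul_apply, Matrix.toLpLin_toLp]
        exact congrArg (WithLp.toLp 2) hv
    exact congrArg WithLp.ofLp h1
  have h1 := M.mulVecLin.finrank_range_add_finrank_ker
  have h2 := (E i).mulVecLin.finrank_range_add_finrank_ker
  have h3 := Submodule.finrank_mono hker
  change Module.finrank ℂ (LinearMap.range (E i).mulVecLin) ≤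
    Module.finrank ℂ (LinearMap.range M.mulVecLin)
  omega

end Operators

end SymmAssocScheme

/-! ### Reordering the relations, and the symmetry from the bipartition -/

namespace SymmAssocScheme

section Relabel

variable {X : Type*} [Fintype X] {D : ℕ}

/-- The scheme with its relations reordered. -/
def relabel (Y : SymmAssocScheme X D) (σ : Equiv.Perm (Fin (D + 1))) (h0 : σ 0 = 0) :
    SymmAssocScheme X D where
  cls y z := σ.symm (Y.cls y z)
  nonempty i := by
    obtain ⟨y, z, h⟩ := Y.nonempty (σ i)
    exact ⟨y, z, by rw [h, Equiv.symm_apply_apply]⟩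
  cls_eq_zero_iff y z := by rw [Equiv.symm_apply_eq, h0, Y.cls_eq_zero_iff]
  symm y z := by rw [Y.symm]
  p h i j := Y.p (σ h) (σ i) (σ j)
  card_eq h i j x y hxy := by
    simp only [Equiv.symm_apply_eq] at hxy ⊢
    exact Y.card_eq _ _ _ x y hxy

variable (Y : SymmAssocScheme X D) (σ : Equiv.Perm (Fin (D + 1))) (h0 : σ 0 = 0)

theorem relabel_boseMesner : (Y.relabel σ h0).boseMesner = Y.boseMesner := by
  have h1 : (Y.relabel σ h0).assocMatrix = Y.assocMatrix ∘ σ := by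
    ext i y z
    change (if σ.symm (Y.cls y z) = i then (1 : ℂ) else 0) = if Y.cls y z = σ i then 1 else 0
    simp only [Equiv.symm_apply_eq]
  rw [boseMesner, h1, σ.surjective.range_comp, boseMesner]

end Relabel

section Sign

variable {X : Type*} [Fintype X] {D : ℕ} {Y : SymmAssocScheme X D}

theorem sign_mul_sign (hp : TriangleConditions Y.p) (hD : 1 ≤ D) {s : X → ℂ}
    (hs : ∀ y, s y * s y = 1) (hs' : ∀ y z, Y.cls y z = 1 → s y * s z = -1) (y z : X) :
    s y * s z = (-1) ^ (Y.cls y z : ℕ) := by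
  suffices key : ∀ n : ℕ, ∀ y z, (Y.cls y z : ℕ) = n → s y * s z = (-1) ^ n from key _ y z rfl
  have h1 : ((1 : Fin (D + 1)) : ℕ) = 1 := by
    rw [Fin.val_one', Nat.mod_eq_of_lt (by omega)]
  intro n
  induction n with
  | zero =>
    intro y z h
    obtain rfl := (Y.cls_eq_zero_iff y z).1 (Fin.ext h)
    rw [hs, pow_zero]
  | succ n ih =>
    intro y z h
    have hn : n < D + 1 := by omega
    have h2 := (hp (Y.cls y z) 1 ⟨n, hn⟩).2 (Or.inl (by simp only [h, h1]; omega))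
    rw [← Y.card_eq _ _ _ y z rfl, Finset.card_ne_zero] at h2
    obtain ⟨w, hw⟩ := h2
    obtain ⟨hyw, hwz⟩ := (Finset.mem_filter.1 hw).2
    calc s y * s z = (s y * s w) * (s w * s z) := by linear_combination -(s y * s z) * hs w
      _ = (-1) ^ (n + 1) := by
          rw [hs' y w hyw, ih w z (by rw [hwz]), pow_succ]
          norm_num

variable [DecidableEq X]
  {E : Fin (D + 1) → Matrix X X ℂ}
  {P Q : Fin (D + 1) → Fin (D + 1) → ℂ} {q : Fin (D + 1) → Fin (D + 1) → Fin (D + 1) → ℂ}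

/-- An idempotent of the algebra has coefficients `0` or `1` in the basis `E`. -/
theorem IsIdempotentOrdering.mul_eq_of_ne_zero (hE : Y.IsIdempotentOrdering E)
    {N : Matrix X X ℂ} (hN : N ∈ Y.boseMesner) (hNN : N * N = N) {k : Fin (D + 1)}
    (h0 : E k * N ≠ 0) : E k * N = E k ∧ N * E k = E k := by
  obtain ⟨c, rfl⟩ := hE.exists_sum_eq hN
  have h1 := congrArg (E k * ·) hNN
  simp only [← mul_assoc, hE.mul_sum, smul_mul_assoc, smul_smul] at h1
  rw [hE.mul_sum] at h0
  have hc : c k ≠ 0 := fun h => h0 (by rw [h, zero_smul])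
  have h2 : c k * c k = c k := smul_left_injective ℂ (hE.ne_zero k) h1
  rw [hE.mul_sum, hE.sum_mul, mul_left_cancel₀ hc (h2.trans (mul_one _).symm), one_smul]
  exact ⟨rfl, rfl⟩

theorem conj_sign_mem {s : X → ℂ} (hs : ∀ y z, s y * s z = (-1) ^ (Y.cls y z : ℕ))
    {M : Matrix X X ℂ} (hM : M ∈ Y.boseMesner) :
    Matrix.diagonal s * M * Matrix.diagonal s ∈ Y.boseMesner := by
  obtain ⟨f, hf⟩ := exists_apply_of_mem hM
  refine mem_boseMesner_of_apply (fun j => (-1) ^ (j : ℕ) * f j) fun y z => ?_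
  rw [Matrix.mul_diagonal, Matrix.diagonal_mul, hf, ← hs]
  ring

/-- In a bipartite scheme, conjugation by the sign matrix sends `E_i` to `E_{D-i}`. -/
theorem IsPQSystem.rev_eq_conj_sign (h : Y.IsPQSystem E P Q q) (hD : 1 ≤ D) {s : X → ℂ}
    (hs1 : ∀ y, s y * s y = 1) (hs' : ∀ y z, Y.cls y z = 1 → s y * s z = -1)
    (i : Fin (D + 1)) : E i.rev = Matrix.diagonal s * E i * Matrix.diagonal s := by
  have hs := sign_mul_sign h.tri hD hs1 hs'
  set S : Matrix X X ℂ := Matrix.diagonal s with hS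
  have hSS : S * S = 1 := by
    rw [hS, Matrix.diagonal_mul_diagonal, ← Matrix.diagonal_one]
    exact congrArg _ (funext hs1)
  have hcancel : ∀ M : Matrix X X ℂ, S * (S * M * S) * S = M := fun M => by
    calc S * (S * M * S) * S = (S * S) * M * (S * S) := by simp only [mul_assoc]
      _ = M := by rw [hSS, one_mul, mul_one]
  have hconj : ∀ M N : Matrix X X ℂ, (S * M * S) * (S * N * S) = S * (M * N) * S := fun M N => by
    calc (S * M * S) * (S * N * S) = S * M * (S * S) * N * S := by simp only [mul_assoc]
      _ = _ := by rw [hSS, mul_one, mul_assoc S M N]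
  have hmem : ∀ l, S * E l * S ∈ Y.boseMesner := fun l => conj_sign_mem hs (h.idem.mem l)
  have hidem : ∀ l, (S * E l * S) * (S * E l * S) = S * E l * S := fun l => by
    rw [hconj, h.idem.mul_self]
  have hne : ∀ l, S * E l * S ≠ 0 := fun l h0 => h.idem.ne_zero l (by
    rw [← hcancel (E l), h0, mul_zero, zero_mul])
  -- Each side is absorbed by the other: the second absorption is the first one conjugated by `S`.
  -- This is primitivity of the conjugated idempotents.
  have key : ∀ k l, E k * (S * E l * S) ≠ 0 → E k = S * E l * S := by
    intro k l hkl
    have h1 := (h.idem.mul_eq_of_ne_zero (hmem l) (hidem l) hkl).2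
    have h2 : E l * (S * E k * S) = S * E k * S := by
      conv_rhs => rw [← h1]
      rw [← hconj, hcancel]
    have h3 := (h.idem.mul_eq_of_ne_zero (hmem k) (hidem k) (by rw [h2]; exact hne k)).1
    rw [← h3, h2, hcancel]
  obtain ⟨n, hn⟩ : ∃ n, E n = S * E 0 * S := by
    by_contra hcon
    push Not at hcon
    apply hne 0
    rw [← one_mul (S * E 0 * S), ← h.idem.complete.complete, Finset.sum_mul]
    exact Finset.sum_eq_zero fun k _ => by_contra fun hk => hcon k (key k 0 hk)
  have hEn : ∀ y z, E n y z = (Fintype.card X : ℂ)⁻¹ * (s y * s z) := by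
    intro y z
    rw [hn, hS, Matrix.mul_diagonal, Matrix.diagonal_mul, h.idem.zero, Matrix.smul_apply,
      Matrix.of_apply, smul_eq_mul]
    ring
  -- Entrywise multiplication by `E n` is, up to the factor `|X|⁻¹`, conjugation by `S`, so for each
  -- `l` at most one `q k l n` is nonzero.
  have hq : ∀ k l, q k l n ≠ 0 → E k = S * E l * S := by
    intro k l hkl
    refine key k l ?_
    have h1 : S * E l * S = ∑ k, q k l n • E k := by
      have h2 : E l ⊙ E n = (Fintype.card X : ℂ)⁻¹ • (S * E l * S) := by
        ext y z
        rw [Matrix.hadamard_apply, hEn, Matrix.smul_apply, hS, Matrix.mul_diagonal,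
          Matrix.diagonal_mul, smul_eq_mul]
        ring
      rw [h.krein l n] at h2
      exact (smul_right_injective _ (inv_ne_zero Y.card_ne_zero) h2).symm
    rw [h1, h.idem.mul_sum]
    exact smul_ne_zero hkl (h.idem.ne_zero k)
  have h1 : ((1 : Fin (D + 1)) : ℕ) = 1 := by
    rw [Fin.val_one', Nat.mod_eq_of_lt (by omega)]
  have hn0 : n ≠ 0 := by
    rintro rfl
    obtain ⟨y, z, hyz⟩ := Y.nonempty 1
    have h2 := hEn y z
    rw [hs' y z hyz, h.idem.zero, Matrix.smul_apply, Matrix.of_apply, smul_eq_mul] at h2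
    have := mul_left_cancel₀ (inv_ne_zero Y.card_ne_zero) h2
    norm_num at this
  have hnpos : 0 < (n : ℕ) := Nat.pos_of_ne_zero fun e => hn0 (Fin.ext e)
  -- If `0 < n < D`, both `q^{n-1}_{1,n}` and `q^{n+1}_{1,n}` are nonzero, forcing `E_{n-1} =
  -- E_{n+1}`.
  have hnD : (n : ℕ) = D := by
    by_contra hnD
    have hlt := n.2
    have ha := hq ⟨n - 1, by omega⟩ 1
      ((h.kreinTri _ 1 n).2 (Or.inr (Or.inr (by simp only [h1]; omega))))
    have hb := hq ⟨n + 1, by omega⟩ 1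
      ((h.kreinTri _ 1 n).2 (Or.inl (by simp only [h1]; omega)))
    have hab := h.idem.linearIndependent.injective (ha.trans hb.symm)
    rw [Fin.mk.injEq] at hab
    omega
  refine hq _ _ ((h.kreinTri _ _ _).2 (Or.inr (Or.inr ?_)))
  rw [Fin.val_rev]
  omega

theorem IsPQSystem.rank_rev_le (h : Y.IsPQSystem E P Q q) (hD : 1 ≤ D) {s : X → ℂ}
    (hs1 : ∀ y, s y * s y = 1) (hs' : ∀ y z, Y.cls y z = 1 → s y * s z = -1)
    (i : Fin (D + 1)) : (E i.rev).rank ≤ (E i).rank := by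
  rw [h.rev_eq_conj_sign hD hs1 hs']
  exact (Matrix.rank_mul_le_left _ _).trans (Matrix.rank_mul_le_right _ _)

end Sign

end SymmAssocScheme

/-! ### Unimodality from symmetry and growth -/

theorem isUnimodalSeq_of_symm {D : ℕ} {m : Fin (D + 1) → ℕ}
    (hsucc : ∀ i j : Fin (D + 1), (j : ℕ) = i + 1 → 2 * (i : ℕ) + 1 ≤ D → m i ≤ m j)
    (hrev : ∀ i, m i.rev = m i) : IsUnimodalSeq m := by
  -- The bound `D + 1`, not `D`, is needed: for odd `D` the reverse of the peak `D / 2` is `(D + 1)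
  -- / 2`.
  have hmono : ∀ n : ℕ, ∀ a b : Fin (D + 1), (b : ℕ) = a + n → 2 * (b : ℕ) ≤ D + 1 →
      m a ≤ m b := by
    intro n
    induction n with
    | zero =>
      intro a b hab _
      rw [Fin.ext hab]
    | succ n ih =>
      intro a b hab hb
      have := b.2
      exact (ih a ⟨a + n, by omega⟩ rfl (by simp only; omega)).trans
        (hsucc _ b (by simp only; omega) (by simp only; omega))
  refine ⟨⟨D / 2, by omega⟩, ?_, ?_⟩
  · intro a ha b hb hab
    rw [Set.mem_Iic, Fin.le_def] at hb
    rw [Fin.le_def] at hab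
    exact hmono (b - a) a b (by omega) (by simp only at hb; omega)
  · intro a ha b hb hab
    rw [Set.mem_Ici, Fin.le_def] at ha
    rw [Fin.le_def] at hab
    simp only at ha
    have := b.2
    rw [← hrev a, ← hrev b]
    refine hmono (b - a) _ _ ?_ ?_
    · rw [Fin.val_rev, Fin.val_rev]
      omega
    · rw [Fin.val_rev]
      omega

theorem mainTheorem2 {X : Type*} [Fintype X] [DecidableEq X] {D : ℕ}
    (Y : SymmAssocScheme X D) (hP : Y.IsBipartitePPolynomial)
    (E : Fin (D + 1) → Matrix X X ℂ) (hQ : Y.IsQPolynomial E) :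
    IsUnimodalSeq (fun i => (E i).rank) := by
  obtain ⟨σ, ⟨h0, hp⟩, ⟨col⟩⟩ := hP
  obtain ⟨hE, q, hq, ht⟩ := hQ
  have hE' : (Y.relabel σ h0).IsIdempotentOrdering E :=
    ⟨fun i => by rw [Y.relabel_boseMesner]; exact hE.mem i, hE.ne_zero, hE.complete, hE.zero⟩
  obtain ⟨P, Q, hPQ⟩ := hE'.exists_eigenmatrices
  have h : (Y.relabel σ h0).IsPQSystem E P Q q := ⟨hp, hE', hq, ht, hPQ⟩
  refine isUnimodalSeq_of_symm (fun i j hij hi => h.rank_le_rank_succ hij hi) fun i => ?_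
  -- For `D = 0` the index `1` equals `0` in `Fin 1`, so the sign argument does not apply; reversal
  -- is then the identity.
  rcases Nat.eq_zero_or_pos D with rfl | hD
  · rw [show i.rev = i from Fin.ext (by omega)]
  set s : X → ℂ := fun y => if col y = 0 then 1 else -1 with hs
  have hs1 : ∀ y, s y * s y = 1 := fun y => by
    simp only [hs]
    split_ifs <;> norm_num
  have hs' : ∀ y z, (Y.relabel σ h0).cls y z = 1 → s y * s z = -1 := by
    intro y z hyz
    have hyz' : Y.cls y z = σ 1 := (Equiv.symm_apply_eq σ).1 hyz
    have hne : y ≠ z := by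
      rintro rfl
      rw [SymmAssocScheme.cls_self] at hyz
      have h1 := congrArg Fin.val hyz
      rw [Fin.val_one', Nat.mod_eq_of_lt (by omega)] at h1
      simp at h1
    have hadj : (Y.graph (σ 1)).Adj y z := ⟨hne, hyz'⟩
    have hcol : col y ≠ col z := col.valid hadj
    simp only [hs]
    split_ifs with hy hz hz
    · exact absurd (hy.trans hz.symm) hcol
    · norm_num
    · norm_num
    · exact absurd (by omega) hcol
  refine le_antisymm (h.rank_rev_le hD hs1 hs' i) ?_
  conv_lhs => rw [← Fin.rev_rev i]
  exact h.rank_rev_le hD hs1 hs' i.rev
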